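/- **Setting.** Consider $x_{k+1}=A(q_k)x_k+B(q_k)u_k+B_w(q_k)w_k$ with $x_k\in\mathbb R^n$, $u_k\in\mathbb R^m$, $w_k\in\mathbb W\subset\mathbb R^{m_w}$, $q_k\in\mathbb Q\subset\mathbb R^{n_q}$. The pairs $(q_k,w_k)$, $k\ge 0$, are i.i.d. with joint law $\mu$, and $(q_k,w_k)\in\mathbb Q\times\mathbb W$ almost surely. The set $\mathbb W$ is bounded and convex, $w_k$ has mean zero, the matrices $A,B,B_w$ are measurable functions of $q$, and $\{(A(q),B(q),B_w(q)):q\in\mathbb Q\}$ is contained in the convex hull of finitely many matrix triples. Let $T\ge 1$ be a horizon, $K\in\mathbb R^{m\times n}$ a gain, $H_x\in\mathbb R^{p_x\times n}$, $h_x$, $H_u\in\mathbb R^{p_u\times m}$, $h_u$, $H_T\in\mathbb R^{p_T\times n}$, $h_T$ constraint data, and $Q,P\in\mathbb R^{n\times n}$, $R\in\mathbb R^{m\times m}$ weights. For a state $x$, corrections $\mathbf v=(v_0,\dots,v_{T-1})$ in $\mathbb R^m$ and a scenario $\xi=(q_\ell,w_\ell)_{\ell=0}^{T-1}$, the predictions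 are $x_{0}=x$, $u_{\ell}=Kx_{\ell}+v_\ell$, $x_{\ell+1}=A(q_\ell)x_\ell+B(q_\ell)u_\ell+B_w(q_\ell)w_\ell$, and the cost is $J_T(x,\mathbf v)=\mathbb E\big[\sum_{\ell=0}^{T-1}(x_\ell^\top Qx_\ell+u_\ell^\top Ru_\ell)+x_T^\top Px_T\big]$, where $\xi\sim\mu^{\otimes T}$. **Scheme.** Offline, draw independent scenarios from $\mu^{\otimes T}$: $N^x_\ell$ scenarios for the state constraints and $N^u_\ell$ for the input constraints at each step $\ell=0,\dots,T-1$, and $N_T$ scenarios for the terminal constraint. Let $\mathbb D$ be the set of all $(x,\mathbf v)$ such that, for every $\ell=0,\dots,T-1$, $H_xx_\ell\le h_x$ on each of the $N_\ell^x$ scenarios and $H_uu_\ell\le h_u$ on each of the $N_\ell^u$ scenarios, and $H_Tx_T\le h_T$ on each of the $N_T$ scenarios. Let $\mathbb C_T=\{(x,v_0):\exists v_1,\dots,v_{T-1},\ (x,(v_0,\dots,v_{T-1}))\in\mathbb D\}$. Let $\mathbb C_{T,x}^\infty$ be the largest set $C$ such that for every $x\in C$ there is $v_0$ with $(x,v_0)\in\mathbb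 C_T$ and $A(q)x+B(q)(Kx+v_0)+B_w(q)w\in C$ for all $q\in\mathbb Q$, $w\in\mathbb W$. Let $\mathbb D_R$ be the set of $(x,\mathbf v)$ with $A(q)x+B(q)(Kx+v_0)+B_w(q)w\in\mathbb C_{T,x}^\infty$ for all $q\in\mathbb Q$, $w\in\mathbb W$. Online, at each time $k$ the OS-SMPC law takes $\mathbf v_k^*=\mathbf v^*(x_k)$ and applies $u_k=Kx_k+v^*_{0|k}$. Here, at every state $x$ at which the constraint $(x,\mathbf v)\in\mathbb D\cap\mathbb D_R$ is feasible, $\mathbf v^*(x)$ is a minimizer of $J_T(x,\cdot)$ subject to this constraint (if the minimum is not attained, any feasible choice is allowed). **Proposition 2 (Constraint Satisfaction).** Let $\delta\in(0,1)$, let $\epsilon_\alpha,\epsilon_\beta,\epsilon_\gamma\in(0,0.14)$ be levels for the rows of $H_x$, $H_u$, $H_T$ respectively, put $$\tilde N(d,\epsilon,\delta)=\frac{4.1}{\epsilon}\Big(\ln\frac{21.64}{\delta}+4.39\,d\,\log_2\frac{8e}{\epsilon}\Big),$$ and suppose that $N_\ell^x\ge\tilde N(n+\ell m,\epsilon_\alpha,\delta)$,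 $N_\ell^u\ge\tilde N(n+\ell m,\epsilon_\beta,\delta)$ and $N_T\ge\tilde N(n+Tm,\epsilon_\gamma,\delta)$ for all $\ell=0,\dots,T-1$ and all rows $\alpha,\beta,\gamma$. Then: 1. For every outcome of the offline sampling, every $x_0\in\mathbb C_{T,x}^\infty$ and every disturbance sequence with values in $\mathbb Q\times\mathbb W$, the closed loop satisfies $H_uu_k\le h_u$ for all $k\ge 0$. 2. For each row $\alpha$, with probability at least $1-\delta$ over the offline samples, the following holds for every $x_0\in\mathbb C_{T,x}^\infty$: for all $k\ge 1$ the closed-loop state satisfies $\mathbb P\{[H_x]_\alpha x_k\le[h_x]_\alpha\}\ge 1-\epsilon_\alpha$, and also the conditional version $\mathbb P\{[H_x]_\alpha x_{k}\le[h_x]_\alpha\mid x_{k-1}\}\ge 1-\epsilon_\alpha$ for every value of $x_{k-1}$ that the closed loop can reach under disturbances in $\mathbb Q\times\mathbb W$. 3. For each row $\alpha$ and each $\ell\in\{0,\dots,T-1\}$, with probability at least $1-\delta$ over the offline samples, the following holds for every $x_0\in\mathbb C_{T,x}^\infty$ and every $k\ge 0$: for every value of $x_k$ that the closed loop can reach under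 disturbances in $\mathbb Q\times\mathbb W$, the state $x_{\ell|k}$ predicted from $x_k$ with the corrections $\mathbf v_k^*$ satisfies $\mathbb P\{[H_x]_\alpha x_{\ell|k}\le[h_x]_\alpha\mid x_k\}\ge 1-\epsilon_\alpha$. -/

import Mathlib

open MeasureTheory
open scoped Matrix

noncomputable section

namespace OSSMPC

/-- Real column vectors. -/
abbrev Vec (n : ℕ) : Type := Fin n → ℝ

/-- One realization `(q, w)` of parametric uncertainty and additive disturbance. -/
abbrev Noise (nq mw : ℕ) : Type := Vec nq × Vec mw

/-- `E` has probability at least `p`, for events that are not assumed measurable: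
`E` contains a measurable event of probability at least `p`.  For a measurable `E` this says
`P E ≥ p`; in general it is the (stronger) inner-measure version. -/
def ProbGE {Ω : Type*} [MeasurableSpace Ω] (P : Measure Ω) (E : Set Ω) (p : ℝ) : Prop :=
  ∃ F : Set Ω, MeasurableSet F ∧ F ⊆ E ∧ ENNReal.ofReal p ≤ P F

/-- The sample bound `Ñ(d, ε, δ) = (4.1/ε) (ln (21.64/δ) + 4.39 d log₂ (8e/ε))`. -/
def Ntilde (d : ℕ) (ε δ : ℝ) : ℝ :=
  4.1 / ε * (Real.log (21.64 / δ) + 4.39 * d * Real.logb 2 (8 * Real.exp 1 / ε))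

/-- The data of the uncertain system `x⁺ = A(q) x + B(q) u + B_w(q) w`.  The measure `law` is the
joint law of `(q_k, w_k)`; the pairs are independent and identically distributed in time. -/
structure Plant (n m mw nq : ℕ) where
  A : Vec nq → Matrix (Fin n) (Fin n) ℝ
  B : Vec nq → Matrix (Fin n) (Fin m) ℝ
  Bw : Vec nq → Matrix (Fin n) (Fin mw) ℝ
  /-- the uncertainty set `ℚ` -/
  QSet : Set (Vec nq)
  /-- the disturbance set `𝕎` -/
  WSet : Set (Vec mw)
  law : Measure (Noise nq mw)
  isProb : IsProbabilityMeasure law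

attribute [instance] Plant.isProb

namespace Plant

variable {n m mw nq : ℕ}

/-- Standing assumptions on the uncertainty: `q ∈ ℚ` and `w ∈ 𝕎` almost surely, `𝕎` is bounded and
convex, `w` has zero mean, and the system matrices (measurable functions of `q`) range over
a set that is contained in a polytope. -/
structure Standing (S : Plant n m mw nq) : Prop where
  measurable_A : ∀ i j, Measurable fun q => S.A q i j
  measurable_B : ∀ i j, Measurable fun q => S.B q i j
  measurable_Bw : ∀ i j, Measurable fun q => S.Bw q i j
  ae_mem : ∀ᵐ d ∂S.law, d.1 ∈ S.QSet ∧ d.2 ∈ S.WSet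
  bounded_W : Bornology.IsBounded S.WSet
  convex_W : Convex ℝ S.WSet
  zero_mean : ∀ j, ∫ d, d.2 j ∂S.law = 0
  polytopic : ∃ G : Set (Matrix (Fin n) (Fin n) ℝ × Matrix (Fin n) (Fin m) ℝ ×
      Matrix (Fin n) (Fin mw) ℝ),
    G.Finite ∧ ∀ q ∈ S.QSet, (S.A q, S.B q, S.Bw q) ∈ convexHull ℝ G

/-- The system equation. -/
def step (S : Plant n m mw nq) (x : Vec n) (u : Vec m) (d : Noise nq mw) : Vec n :=
  S.A d.1 *ᵥ x + S.B d.1 *ᵥ u + S.Bw d.1 *ᵥ d.2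

/-- A disturbance sequence takes its values in `ℚ × 𝕎`. -/
def Admissible (S : Plant n m mw nq) (d : ℕ → Noise nq mw) : Prop :=
  ∀ k, (d k).1 ∈ S.QSet ∧ (d k).2 ∈ S.WSet

/-- The law of the disturbances over a prediction horizon of length `T`. -/
def horizonLaw (S : Plant n m mw nq) (T : ℕ) : Measure (Fin T → Noise nq mw) :=
  Measure.pi fun _ => S.law

/-- The law of the disturbance sequence that acts on the closed loop. -/
def onlineLaw (S : Plant n m mw nq) : Measure (ℕ → Noise nq mw) :=
  Measure.infinitePi fun _ => S.law

end Plant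

/-- Prestabilizing gain, constraint data and weights of the finite-horizon problem. -/
structure Design (n m px pu pT : ℕ) where
  K : Matrix (Fin m) (Fin n) ℝ
  Hx : Matrix (Fin px) (Fin n) ℝ
  hx : Vec px
  Hu : Matrix (Fin pu) (Fin m) ℝ
  hu : Vec pu
  HT : Matrix (Fin pT) (Fin n) ℝ
  hT : Vec pT
  Q : Matrix (Fin n) (Fin n) ℝ
  R : Matrix (Fin m) (Fin m) ℝ
  P : Matrix (Fin n) (Fin n) ℝ

/-- The numbers of offline samples for the state constraints and the input constraints at each
prediction step, and for the terminal constraint. -/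
structure Counts (T : ℕ) where
  Nx : Fin T → ℕ
  Nu : Fin T → ℕ
  NT : ℕ

/-- The labels of all offline samples. -/
abbrev Counts.Idx {T : ℕ} (c : Counts T) : Type :=
  (Σ l : Fin T, Fin (c.Nx l)) ⊕ (Σ l : Fin T, Fin (c.Nu l)) ⊕ Fin c.NT

/-- A multisample: one disturbance scenario over the horizon for each label. -/
abbrev Samples {T : ℕ} (nq mw : ℕ) (c : Counts T) : Type :=
  c.Idx → Fin T → Noise nq mw

section Scheme

variable {n m mw nq px pu pT T : ℕ}

/-- The predicted state `x_{l|k}`, for `l ≤ T`, from `x_{0|k} = x`, with the predicted input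
`u_{l|k} = K x_{l|k} + v_{l|k}` and the disturbances `ξ` (only `l ≤ T` is used; later values are
constant by convention). -/
def predState (S : Plant n m mw nq) (D : Design n m px pu pT) (x : Vec n) (v : Fin T → Vec m)
    (ξ : Fin T → Noise nq mw) : ℕ → Vec n
  | 0 => x
  | l + 1 =>
    if h : l < T then
      S.step (predState S D x v ξ l) (D.K *ᵥ predState S D x v ξ l + v ⟨l, h⟩) (ξ ⟨l, h⟩)
    else predState S D x v ξ l

/-- The predicted input `u_{l|k} = K x_{l|k} + v_{l|k}`. -/
def predInput (S : Plant n m mw nq) (D : Design n m px pu pT) (x : Vec n) (v : Fin T → Vec m)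
    (ξ : Fin T → Noise nq mw) (l : Fin T) : Vec m :=
  D.K *ᵥ predState S D x v ξ l + v l

/-- The expected finite-horizon cost `J_T(x, v)`. -/
def cost (S : Plant n m mw nq) (D : Design n m px pu pT) (x : Vec n) (v : Fin T → Vec m) : ℝ :=
  ∫ ξ : Fin T → Noise nq mw,
    ((∑ l : Fin T,
        (predState S D x v ξ l ⬝ᵥ D.Q *ᵥ predState S D x v ξ l
          + predInput S D x v ξ l ⬝ᵥ D.R *ᵥ predInput S D x v ξ l))
      + predState S D x v ξ T ⬝ᵥ D.P *ᵥ predState S D x v ξ T) ∂(S.horizonLaw T)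

/-- The law of the offline multisample: all scenarios are drawn independently. -/
def sampleLaw (S : Plant n m mw nq) (c : Counts T) : Measure (Samples nq mw c) :=
  Measure.pi fun _ => S.horizonLaw T

/-- The sampled constraint set `𝔻`: sampled state and input constraints at the prediction steps
`0, …, T - 1`, and the sampled terminal constraint. -/
def sampledSet (S : Plant n m mw nq) (D : Design n m px pu pT) {c : Counts T}
    (s : Samples nq mw c) : Set (Vec n × (Fin T → Vec m)) :=
  {z | (∀ (l : Fin T) (i : Fin (c.Nx l)),
          D.Hx *ᵥ predState S D z.1 z.2 (s (Sum.inl ⟨l, i⟩)) l ≤ D.hx) ∧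
       (∀ (l : Fin T) (i : Fin (c.Nu l)),
          D.Hu *ᵥ predInput S D z.1 z.2 (s (Sum.inr (Sum.inl ⟨l, i⟩))) l ≤ D.hu) ∧
       (∀ i : Fin c.NT,
          D.HT *ᵥ predState S D z.1 z.2 (s (Sum.inr (Sum.inr i))) T ≤ D.hT)}

variable [NeZero T]

/-- The set `ℂ_T` of feasible states and first corrections. -/
def firstStepSet (S : Plant n m mw nq) (D : Design n m px pu pT) {c : Counts T}
    (s : Samples nq mw c) : Set (Vec n × Vec m) :=
  {p | ∃ v : Fin T → Vec m, v 0 = p.2 ∧ (p.1, v) ∈ sampledSet S D s}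

/-- `C` is robust control invariant for the system with `u = K x + v₀`, subject to
`(x, v₀) ∈ ℂ_T`. -/
def IsRCI (S : Plant n m mw nq) (D : Design n m px pu pT) {c : Counts T}
    (s : Samples nq mw c) (C : Set (Vec n)) : Prop :=
  ∀ x ∈ C, ∃ v₀ : Vec m, (x, v₀) ∈ firstStepSet S D s ∧
    ∀ q ∈ S.QSet, ∀ w ∈ S.WSet, S.step x (D.K *ᵥ x + v₀) (q, w) ∈ C

/-- The maximal robust control invariant set `ℂ_{T,x}^∞`: the union of all robust control
invariant sets. -/
def maxRCI (S : Plant n m mw nq) (D : Design n m px pu pT) {c : Counts T}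
    (s : Samples nq mw c) : Set (Vec n) :=
  {x | ∃ C : Set (Vec n), IsRCI S D s C ∧ x ∈ C}

/-- The union of all robust control invariant sets is the greatest one. -/
theorem isGreatest_maxRCI (S : Plant n m mw nq) (D : Design n m px pu pT) {c : Counts T}
    (s : Samples nq mw c) : IsGreatest {C | IsRCI S D s C} (maxRCI S D s) := by
  refine ⟨?_, fun C hC x hx => ⟨C, hC, hx⟩⟩
  rintro x ⟨C, hC, hx⟩
  obtain ⟨v₀, h₁, h₂⟩ := hC x hx
  exact ⟨v₀, h₁, fun q hq w hw => ⟨C, hC, h₂ q hq w hw⟩⟩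

/-- The first step constraint set `𝔻_R`: the successor state lies in `ℂ_{T,x}^∞` for all
`q ∈ ℚ` and `w ∈ 𝕎`. -/
def robustSet (S : Plant n m mw nq) (D : Design n m px pu pT) {c : Counts T}
    (s : Samples nq mw c) : Set (Vec n × (Fin T → Vec m)) :=
  {z | ∀ q ∈ S.QSet, ∀ w ∈ S.WSet, S.step z.1 (D.K *ᵥ z.1 + z.2 0) (q, w) ∈ maxRCI S D s}

/-- The correction sequences that the online program admits at the state `x`. -/
def feasible (S : Plant n m mw nq) (D : Design n m px pu pT) {c : Counts T}
    (s : Samples nq mw c) (x : Vec n) : Set (Fin T → Vec m) :=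
  {v | (x, v) ∈ sampledSet S D s ∩ robustSet S D s}

/-- `κ` is the map `x ↦ v*(x)` of the online program: wherever the program is feasible, `κ x` is
feasible, and it minimizes the cost over all feasible sequences (whenever the minimum is attained,
so that such a map exists for all data). -/
def IsLaw (S : Plant n m mw nq) (D : Design n m px pu pT) {c : Counts T}
    (s : Samples nq mw c) (κ : Vec n → Fin T → Vec m) : Prop :=
  ∀ x, (feasible S D s x).Nonempty →
    κ x ∈ feasible S D s x ∧
    ((∃ v ∈ feasible S D s x, IsMinOn (cost S D x) (feasible S D s x) v) →
      IsMinOn (cost S D x) (feasible S D s x) (κ x))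

/-- The applied input `u = K x + v₀*(x)`. -/
def appliedInput (D : Design n m px pu pT) (κ : Vec n → Fin T → Vec m) (x : Vec n) : Vec m :=
  D.K *ᵥ x + κ x 0

/-- The closed-loop trajectory from `x₀` for the disturbance sequence `d`. -/
def closedLoop (S : Plant n m mw nq) (D : Design n m px pu pT) (κ : Vec n → Fin T → Vec m)
    (x₀ : Vec n) (d : ℕ → Noise nq mw) : ℕ → Vec n
  | 0 => x₀
  | k + 1 => S.step (closedLoop S D κ x₀ d k) (appliedInput D κ (closedLoop S D κ x₀ d k)) (d k)

end Scheme

end OSSMPC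

end

/-!
The online program at a state of the maximal robust control invariant set `maxRCI` is feasible,
because the definition of invariance provides an admissible first correction, and every feasible
choice keeps the successor in `maxRCI`. Under disturbances in `ℚ × 𝕎` the closed loop therefore
never leaves `maxRCI` (`IsLaw.closedLoop_mem_maxRCI`).

At prediction step `0` neither the state nor the input depends on the scenario. As the sample bound
is positive, there is at least one sample, and it enforces the state and the input constraint at
step `0` exactly. The input constraints thus hold along every admissible closed loop. The
state constraints hold on `maxRCI`, hence at all closed-loop states and for almost every
disturbance, which is stronger than the chance constraints on the closed loop.

The probabilistic content is in the chance constraints on the predicted states, which come from an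
ε-net theorem. For a fixed scenario the predicted state at step `l` is affine in the `d = n + l * m`
unknowns `x, v₀, …, v_{l-1}`, so one row of the state constraint is a random affine inequality in
these unknowns. Such inequalities shatter no `d + 1` scenarios, and the Sauer–Shelah lemma bounds the
number of their traces on a double sample (`ncard_range_trace_le`). Suppose that some point
satisfies all `N` sampled inequalities but violates the random one with probability more than `ε`.
By a Chernoff bound (`pi_count_lt_le_half`) an independent second sample contains at least `ε N / 2`
violations with probability at least one half, whereas a random exchange of the two samples, pair by
pair, leaves all these violations in the second half with probability at most `2 ^ (-ε N / 2)` for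
each trace (`card_exchange_mul_le`). The sample bound makes the resulting estimate at most `δ`
(`two_mul_sum_choose_le`).

The point is arbitrary in this theorem, so the optimal corrections, which depend on the samples, are
covered without any measurability of the control law. Uncountable unions of events are measured
by outer measure; `measure_exists_affine_missed_mul_le` reduces them to countable ones.
-/

namespace OSSMPC

/-! ### Traces of a family of half-spaces -/

/-- The Chernoff form of the Sauer–Shelah sum: bounding it by `t ^ (-d) * exp (t * M)`, with the
free parameter `t`, spares any manipulation of `log M`. -/
theorem sum_choose_mul_pow_le (M d : ℕ) {t : ℝ} (ht₀ : 0 ≤ t) (ht₁ : t ≤ 1) :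
    (∑ k ∈ Finset.Iic d, (M.choose k : ℝ)) * t ^ d ≤ Real.exp (t * M) := by
  have h₁ : (∑ k ∈ Finset.Iic d, (M.choose k : ℝ)) * t ^ d
      ≤ ∑ k ∈ Finset.range (M + 1), t ^ k * (M.choose k : ℝ) := by
    rw [Finset.sum_mul]
    calc ∑ k ∈ Finset.Iic d, (M.choose k : ℝ) * t ^ d
        ≤ ∑ k ∈ Finset.Iic d, t ^ k * (M.choose k : ℝ) := by
          refine Finset.sum_le_sum fun k hk => ?_
          rw [mul_comm]
          exact mul_le_mul_of_nonneg_right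
            (pow_le_pow_of_le_one ht₀ ht₁ (Finset.mem_Iic.1 hk)) (Nat.cast_nonneg _)
      _ ≤ ∑ k ∈ Finset.Iic d ∪ Finset.range (M + 1), t ^ k * (M.choose k : ℝ) :=
          Finset.sum_le_sum_of_subset_of_nonneg Finset.subset_union_left
            fun k _ _ => by positivity
      _ = ∑ k ∈ Finset.range (M + 1), t ^ k * (M.choose k : ℝ) := by
          refine (Finset.sum_subset Finset.subset_union_right fun k _ hk => ?_).symm
          rw [Nat.choose_eq_zero_of_lt (by simpa using hk)]
          simp
  refine h₁.trans ?_
  have h₂ := add_pow t 1 M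
  simp only [one_pow, mul_one] at h₂
  rw [← h₂, mul_comm t, Real.exp_nat_mul]
  have := Real.add_one_le_exp t
  gcongr

/-- Affine inequalities in `d` unknowns cut out at most as many subsets of a finite set of points
as a family of Vapnik–Chervonenkis dimension `d`. If `d + 1` points were shattered, a nontrivial
relation `∑ j, g j • a j = 0` would make `∑ j, g j * (a j z - b j)` independent of `z`; but it is
nonnegative when the violated inequalities are those with `0 < g j`, nonpositive when they are
those with `g j < 0`, and one of the two is strict. -/
theorem ncard_range_trace_le {E J : Type*} [AddCommGroup E] [Module ℝ E] [FiniteDimensional ℝ E]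
    [Fintype J] (a : J → E →ₗ[ℝ] ℝ) (b : J → ℝ) :
    (Set.range fun z : E => {j | b j < a j z}).ncard
      ≤ ∑ k ∈ Finset.Iic (Module.finrank ℝ E), (Fintype.card J).choose k := by
  classical
  set 𝒜 : Finset (Finset J) :=
    (Set.range fun z : E => Finset.univ.filter fun j => b j < a j z).toFinset with h𝒜
  have hcard : (Set.range fun z : E => {j | b j < a j z}).ncard ≤ 𝒜.card := by
    have : (Set.range fun z : E => {j | b j < a j z}) = (fun u : Finset J => (u : Set J)) '' 𝒜 := by
      ext u
      simp [h𝒜]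
    rw [this, ← Set.ncard_coe_finset 𝒜]
    exact Set.ncard_image_le 𝒜.finite_toSet
  refine hcard.trans (𝒜.card_le_card_shatterer.trans
    (Finset.card_shatterer_le_sum_vcDim.trans ?_))
  refine Finset.sum_le_sum_of_subset (Finset.Iic_subset_Iic.2 (Finset.sup_le fun u hu => ?_))
  rw [Finset.mem_shatterer] at hu
  by_contra! hlt
  have hdep : ¬ LinearIndependent ℝ fun j : u => a j := by
    intro hli
    have := hli.fintype_card_le_finrank
    rw [Fintype.card_coe, Subspace.dual_finrank_eq (K := ℝ) (V := E)] at this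
    omega
  obtain ⟨g, hg, j₀, hj₀⟩ := Fintype.not_linearIndependent_iff.1 hdep
  have hconst : ∀ z : E, ∑ j : u, g j * (a j z - b j) = - ∑ j : u, g j * b j := by
    intro z
    have := congrArg (fun φ : E →ₗ[ℝ] ℝ => φ z) hg
    simp only [LinearMap.sum_apply, LinearMap.smul_apply, smul_eq_mul, LinearMap.zero_apply] at this
    simp only [mul_sub, Finset.sum_sub_distrib, this, zero_sub]
  have hpat : ∀ r : u → Prop, ∃ z : E, ∀ j : u, b j < a j z ↔ r j := by
    intro r
    obtain ⟨w, hw, hwr⟩ := hu (t := (Finset.univ.filter r).map (Function.Embedding.subtype _))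
      (by intro x; simp +contextual)
    obtain ⟨z, rfl⟩ : ∃ z : E, (Finset.univ.filter fun j => b j < a j z) = w := by
      simpa [h𝒜] using hw
    refine ⟨z, fun j => ?_⟩
    have := Finset.ext_iff.1 hwr j
    simpa using this
  obtain ⟨z₁, hz₁⟩ := hpat fun j => 0 < g j
  obtain ⟨z₂, hz₂⟩ := hpat fun j => g j < 0
  have h₁ : ∀ j, 0 ≤ g j * (a j z₁ - b j) := by
    intro j
    rcases lt_or_ge 0 (g j) with h | h
    · exact mul_nonneg h.le (sub_nonneg.2 ((hz₁ j).2 h).le)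
    · exact mul_nonneg_of_nonpos_of_nonpos h
        (sub_nonpos.2 (not_lt.1 fun h' => h.not_gt ((hz₁ j).1 h')))
  have h₂ : ∀ j, g j * (a j z₂ - b j) ≤ 0 := by
    intro j
    rcases lt_or_ge (g j) 0 with h | h
    · exact mul_nonpos_of_nonpos_of_nonneg h.le (sub_nonneg.2 ((hz₂ j).2 h).le)
    · exact mul_nonpos_of_nonneg_of_nonpos h
        (sub_nonpos.2 (not_lt.1 fun h' => h.not_gt ((hz₂ j).1 h')))
  have h₃ : ∑ j : u, g j * (a j z₁ - b j) = ∑ j : u, g j * (a j z₂ - b j) := by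
    rw [hconst, hconst]
  have h₄ : ∑ j : u, g j * (a j z₂ - b j) < ∑ j : u, g j * (a j z₁ - b j) := by
    refine Finset.sum_lt_sum (fun j _ => (h₂ j).trans (h₁ j)) ⟨j₀, Finset.mem_univ _, ?_⟩
    rcases lt_or_gt_of_ne hj₀ with h | h
    · exact (mul_neg_of_neg_of_pos h (sub_pos.2 ((hz₂ j₀).2 h))).trans_le (h₁ j₀)
    · exact (h₂ j₀).trans_lt (mul_pos h (sub_pos.2 ((hz₁ j₀).2 h)))
  exact h₄.ne' h₃

/-! ### Double samples and the ε-net bound -/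

/-- A subfamily of an independent sample is an independent sample. -/
theorem measurePreserving_comp_pi {Ξ I J : Type*} [MeasurableSpace Ξ] [Fintype I] [Fintype J]
    (μ : Measure Ξ) [IsProbabilityMeasure μ] {f : J → I} (hf : f.Injective) :
    MeasurePreserving (fun (s : I → Ξ) j => s (f j)) (Measure.pi fun _ => μ)
      (Measure.pi fun _ => μ) := by
  classical
  have hm : Measurable fun (s : I → Ξ) j => s (f j) := by fun_prop
  refine ⟨hm, (Measure.pi_eq fun t ht => ?_).symm⟩
  rw [Measure.map_apply hm (MeasurableSet.univ_pi ht)]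
  have : (fun (s : I → Ξ) j => s (f j)) ⁻¹' Set.univ.pi t
      = Set.univ.pi fun i => ⋂ (j : J) (_ : f j = i), t j := by
    ext s
    simp only [Set.mem_preimage, Set.mem_univ_pi, Set.mem_iInter]
    exact ⟨fun h i j hj => hj ▸ h j, fun h j => h _ j rfl⟩
  rw [this, Measure.pi_pi]
  have hI : ∀ j, (⋂ (j' : J) (_ : f j' = f j), t j') = t j := by
    intro j
    ext x
    simp only [Set.mem_iInter]
    exact ⟨fun h => h j rfl, fun h j' hj => hf hj ▸ h⟩
  rw [← Finset.prod_subset (Finset.subset_univ (Finset.univ.image f)),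
    Finset.prod_image fun _ _ _ _ h => hf h]
  · simp [hI]
  · intro i _ hi
    have : (⋂ (j : J) (_ : f j = i), t j) = Set.univ := by
      simp only [Set.iInter_eq_univ]
      intro j hj
      exact absurd (Finset.mem_image_of_mem f (Finset.mem_univ j)) (hj ▸ hi)
    rw [this, measure_univ]

/-- Two independent samples of size `N` form one sample indexed by `Fin N × Bool`. -/
theorem measurePreserving_double {Ξ : Type*} [MeasurableSpace Ξ] (μ : Measure Ξ)
    [IsProbabilityMeasure μ] (N : ℕ) :
    MeasurePreserving
      (fun (s : (Fin N → Ξ) × (Fin N → Ξ)) (j : Fin N × Bool) => cond j.2 (s.2 j.1) (s.1 j.1))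
      ((Measure.pi fun _ => μ).prod (Measure.pi fun _ => μ)) (Measure.pi fun _ => μ) := by
  have hm : Measurable
      (fun (s : (Fin N → Ξ) × (Fin N → Ξ)) (j : Fin N × Bool) => cond j.2 (s.2 j.1) (s.1 j.1)) := by
    refine measurable_pi_lambda _ ?_
    rintro ⟨j, b⟩
    cases b <;> simp only [cond_true, cond_false] <;> fun_prop
  refine ⟨hm, (Measure.pi_eq fun t ht => ?_).symm⟩
  rw [Measure.map_apply hm (MeasurableSet.univ_pi ht)]
  have : (fun (s : (Fin N → Ξ) × (Fin N → Ξ)) (j : Fin N × Bool) =>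
        cond j.2 (s.2 j.1) (s.1 j.1)) ⁻¹' Set.univ.pi t
      = (Set.univ.pi fun j => t (j, false)) ×ˢ (Set.univ.pi fun j => t (j, true)) := by
    ext s
    simp only [Set.mem_preimage, Set.mem_univ_pi, Prod.forall, Bool.forall_bool, Set.mem_prod,
      cond_true, cond_false]
    exact forall_and
  rw [this, Measure.prod_prod, Measure.pi_pi, Measure.pi_pi, Fintype.prod_prod_type]
  simp only [Fintype.prod_bool, Finset.prod_mul_distrib]
  rw [mul_comm]

/-- A Chernoff bound, from the moment `E[2 ^ (-count)] = (1 - p / 2) ^ N`. -/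
theorem pi_count_lt_le_half {Ξ : Type*} [MeasurableSpace Ξ] (μ : Measure Ξ)
    [IsProbabilityMeasure μ] {V : Set Ξ} (hV : MeasurableSet V) {ε : ℝ} (hε : ε < μ.real V)
    {N : ℕ} (hN : 12 ≤ ε * N) :
    (Measure.pi fun _ : Fin N => μ).real {s | ({j | s j ∈ V}.ncard : ℝ) < ε * N / 2} ≤ 1 / 2 := by
  classical
  set ν := Measure.pi fun _ : Fin N => μ
  set φ : Ξ → ℝ := fun x => 1 - V.indicator (fun _ => (1 / 2 : ℝ)) x with hφ
  have hφ₀ : ∀ x, 0 ≤ φ x := fun x => by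
    by_cases h : x ∈ V <;> norm_num [hφ, h]
  have hφ₁ : ∀ x, φ x ≤ 1 := fun x => by
    by_cases h : x ∈ V <;> norm_num [hφ, h]
  have hφm : Measurable φ := measurable_const.sub (measurable_const.indicator hV)
  have hφI : ∫ x, φ x ∂μ = 1 - μ.real V / 2 := by
    rw [hφ, integral_sub (integrable_const _) ((integrable_const _).indicator hV),
      integral_indicator_const _ hV]
    simp [div_eq_mul_inv]
  have hprod : ∀ s : Fin N → Ξ, ∏ j, φ (s j) = (1 / 2 : ℝ) ^ {j | s j ∈ V}.ncard := by
    intro s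
    have h : ∀ j, φ (s j) = if s j ∈ V then (1 / 2 : ℝ) else 1 := fun j => by
      by_cases h : s j ∈ V <;> norm_num [hφ, h]
    simp only [h]
    rw [Finset.prod_ite, Finset.prod_const, Finset.prod_const_one, mul_one,
      Set.ncard_eq_toFinset_card']
    simp
  have hint : Integrable (fun s : Fin N → Ξ => ∏ j, φ (s j)) ν := by
    refine Integrable.of_bound
      (Finset.measurable_prod _ fun j _ => hφm.comp (measurable_pi_apply j)).aestronglyMeasurable
      1 (ae_of_all _ fun s => ?_)
    rw [Real.norm_of_nonneg (Finset.prod_nonneg fun j _ => hφ₀ _)]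
    exact Finset.prod_le_one (fun j _ => hφ₀ _) fun j _ => hφ₁ _
  have hmarkov := mul_meas_ge_le_integral_of_nonneg
    (ae_of_all ν fun s : Fin N → Ξ => Finset.prod_nonneg fun j _ => hφ₀ (s j)) hint
    (Real.exp (-(Real.log 2 * (ε * N / 2))))
  have hE : ∫ s : Fin N → Ξ, ∏ j, φ (s j) ∂ν ≤ Real.exp (-(ε * N / 2)) := by
    rw [integral_fintype_prod_eq_prod (fun _ => φ)]
    simp only [hφI, Finset.prod_const, Finset.card_univ, Fintype.card_fin]
    have h₁ : 1 - μ.real V / 2 ≤ Real.exp (-(ε / 2)) := by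
      have := Real.add_one_le_exp (-(ε / 2))
      linarith
    have h₀ : 0 ≤ 1 - μ.real V / 2 := by
      have : μ.real V ≤ 1 := measureReal_le_one
      linarith
    calc _ ≤ Real.exp (-(ε / 2)) ^ N := pow_le_pow_left₀ h₀ h₁ N
      _ = _ := by rw [← Real.exp_nat_mul]; ring_nf
  have hsub : {s : Fin N → Ξ | ({j | s j ∈ V}.ncard : ℝ) < ε * N / 2}
      ⊆ {s | Real.exp (-(Real.log 2 * (ε * N / 2))) ≤ ∏ j, φ (s j)} := by
    intro s hs
    rw [Set.mem_ofPred_eq] at hs ⊢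
    rw [hprod, one_div, inv_pow, ← Real.exp_log (x := 2 ^ _) (by positivity), Real.log_pow,
      ← Real.exp_neg, Real.exp_le_exp]
    have := Real.log_pos one_lt_two
    nlinarith
  have hmono := measureReal_mono (μ := ν) hsub
  have hlog : Real.log 2 < 0.7 := by linarith [Real.log_two_lt_d9]
  -- `exp (ε N (log 2 - 1) / 2) ≤ exp (-1.8)`, and `1.8 > log 2`
  have hfin : Real.exp (-(ε * N / 2))
      ≤ Real.exp (-(Real.log 2 * (ε * N / 2))) * (1 / 2) := by
    have hhalf : (1 / 2 : ℝ) = Real.exp (-Real.log 2) := by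
      rw [Real.exp_neg, Real.exp_log two_pos, one_div]
    rw [hhalf, ← Real.exp_add, Real.exp_le_exp]
    nlinarith
  have hpos := Real.exp_pos (-(Real.log 2 * (ε * N / 2)))
  exact hmono.trans (le_of_mul_le_mul_left ((hmarkov.trans hE).trans hfin) hpos)

/-- For a fixed double sample with trace `τ`, a uniformly random exchange `σ` of the pairs moves
all of at least `k` violations to the second half with probability at most `2 ^ (-k)`. -/
theorem card_exchange_mul_le (N k : ℕ) (τ : Set (Fin N × Bool)) :
    {σ : Fin N → Bool | (∀ j, (j, σ j) ∉ τ) ∧ k ≤ {j | (j, !σ j) ∈ τ}.ncard}.ncard * 2 ^ k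
      ≤ 2 ^ N := by
  classical
  set S := {σ : Fin N → Bool | (∀ j, (j, σ j) ∉ τ) ∧ k ≤ {j | (j, !σ j) ∈ τ}.ncard} with hS
  rcases S.eq_empty_or_nonempty with h | ⟨σ₀, h₀, hk⟩
  · simp [h]
  set K : Finset (Fin N) := Finset.univ.filter fun j => (j, !σ₀ j) ∈ τ with hK
  have hkK : k ≤ K.card := by
    rw [← Set.ncard_coe_finset]
    simpa [hK] using hk
  have hsub : S ⊆ (Fintype.piFinset fun j => if j ∈ K then {σ₀ j} else Finset.univ :
      Finset (Fin N → Bool)) := by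
    intro σ hσ
    rw [Finset.mem_coe, Fintype.mem_piFinset]
    intro j
    split_ifs with hj
    · rw [Finset.mem_singleton]
      by_contra hne
      have : σ j = !σ₀ j := by
        cases h₁ : σ j <;> cases h₂ : σ₀ j <;> simp_all
      exact hσ.1 j (this ▸ (Finset.mem_filter.1 hj).2)
    · exact Finset.mem_univ _
  have hcard := Set.ncard_le_ncard hsub (Finset.finite_toSet _)
  rw [Set.ncard_coe_finset, Fintype.card_piFinset] at hcard
  have hprod : ∏ j, (if j ∈ K then {σ₀ j} else Finset.univ : Finset Bool).card
      = 2 ^ (N - K.card) := by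
    have : ∀ j, (if j ∈ K then {σ₀ j} else Finset.univ : Finset Bool).card
        = if j ∈ K then 1 else 2 := fun j => by split_ifs <;> simp
    simp only [this]
    rw [Finset.prod_ite, Finset.prod_const_one, one_mul, Finset.prod_const]
    congr 1
    rw [Finset.filter_not, Finset.card_sdiff_of_subset (Finset.filter_subset _ _)]
    simp
  rw [hprod] at hcard
  have hKN : K.card ≤ N := by simpa using K.card_le_univ
  calc S.ncard * 2 ^ k ≤ 2 ^ (N - K.card) * 2 ^ K.card :=
        Nat.mul_le_mul hcard (Nat.pow_le_pow_right two_pos hkK)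
    _ = 2 ^ N := by rw [← pow_add, Nat.sub_add_cancel hKN]

/-- Exchanging the two halves of a double sample pair by pair preserves its law, so that the
probability of missing a set in the first half and hitting it `k` times in the second one is an
average over exchanges; a union bound over the at most `G` traces remains. -/
theorem measure_exists_missed_hit_mul_le {Ξ ι : Type*} [MeasurableSpace Ξ] [Countable ι]
    (μ : Measure Ξ) [IsProbabilityMeasure μ] {V : ι → Set Ξ} (hV : ∀ i, MeasurableSet (V i))
    {N G : ℕ} (k : ℕ)
    (hG : ∀ p : Fin N × Bool → Ξ, (Set.range fun i => {j | p j ∈ V i}).ncard ≤ G) :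
    MeasurableSet {p : Fin N × Bool → Ξ |
      ∃ i, (∀ j, p (j, false) ∉ V i) ∧ k ≤ {j | p (j, true) ∈ V i}.ncard} ∧
    (Measure.pi fun _ : Fin N × Bool => μ)
      {p | ∃ i, (∀ j, p (j, false) ∉ V i) ∧ k ≤ {j | p (j, true) ∈ V i}.ncard} * 2 ^ k ≤ G := by
  classical
  set ν := Measure.pi fun _ : Fin N × Bool => μ
  set B := {p : Fin N × Bool → Ξ |
    ∃ i, (∀ j, p (j, false) ∉ V i) ∧ k ≤ {j | p (j, true) ∈ V i}.ncard} with hB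
  have hBm : MeasurableSet B := by
    have hτ : ∀ i, Measurable fun (p : Fin N × Bool → Ξ) => {j | p j ∈ V i} := fun i =>
      measurable_set_iff.2 fun j => measurableSet_setOfPred.1 (measurable_pi_apply j (hV i))
    have : B = ⋃ i, (fun (p : Fin N × Bool → Ξ) => {j | p j ∈ V i}) ⁻¹'
        {τ | (∀ j, (j, false) ∉ τ) ∧ k ≤ {j | (j, true) ∈ τ}.ncard} := by
      ext p
      simp [hB]
    rw [this]
    exact MeasurableSet.iUnion fun i => hτ i (Set.toFinite _).measurableSet
  refine ⟨hBm, ?_⟩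
  set e : (Fin N → Bool) → Fin N × Bool → Fin N × Bool := fun σ j => (j.1, xor j.2 (σ j.1)) with he
  have hinj : ∀ σ, (e σ).Injective := by
    rintro σ ⟨j, x⟩ ⟨j', x'⟩ h
    obtain ⟨rfl, h⟩ := Prod.mk.inj h
    simpa using h
  have hpres : ∀ σ, MeasurePreserving (fun (p : Fin N × Bool → Ξ) j => p (e σ j)) ν ν := fun σ =>
    measurePreserving_comp_pi μ (hinj σ)
  -- the union bound over the traces
  have hcount : ∀ p : Fin N × Bool → Ξ,
      {σ : Fin N → Bool | (fun j => p (e σ j)) ∈ B}.ncard * 2 ^ k ≤ G * 2 ^ N := by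
    intro p
    set R := (Set.range fun i => {j | p j ∈ V i}).toFinset with hR
    have hsub : {σ : Fin N → Bool | (fun j => p (e σ j)) ∈ B} ⊆ ⋃ τ ∈ R,
        {σ : Fin N → Bool | (∀ j, (j, σ j) ∉ τ) ∧ k ≤ {j | (j, !σ j) ∈ τ}.ncard} := by
      rintro σ ⟨i, h₁, h₂⟩
      refine Set.mem_biUnion (x := {j | p j ∈ V i}) (by simp [hR]) ⟨fun j => ?_, ?_⟩
      · simpa [he] using h₁ j
      · simpa [he] using h₂
    calc _ ≤ (∑ τ ∈ R,
          {σ : Fin N → Bool | (∀ j, (j, σ j) ∉ τ) ∧ k ≤ {j | (j, !σ j) ∈ τ}.ncard}.ncard)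
            * 2 ^ k :=
          Nat.mul_le_mul_right _ ((Set.ncard_le_ncard hsub (Set.toFinite _)).trans
            (Finset.set_ncard_biUnion_le _ _))
      _ ≤ ∑ τ ∈ R, 2 ^ N := by
          rw [Finset.sum_mul]
          exact Finset.sum_le_sum fun τ _ => card_exchange_mul_le N k τ
      _ ≤ G * 2 ^ N := by
          rw [Finset.sum_const, smul_eq_mul]
          refine Nat.mul_le_mul_right _ ?_
          rw [hR, ← Set.ncard_eq_toFinset_card']
          exact hG p
  have havg : (2 : ENNReal) ^ N * ν B
      = ∫⁻ p, ({σ : Fin N → Bool | (fun j => p (e σ j)) ∈ B}.ncard : ENNReal) ∂ν := by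
    have h₁ : ∀ p : Fin N × Bool → Ξ,
        ({σ : Fin N → Bool | (fun j => p (e σ j)) ∈ B}.ncard : ENNReal)
          = ∑ σ : Fin N → Bool,
            ((fun (p : Fin N × Bool → Ξ) j => p (e σ j)) ⁻¹' B).indicator 1 p := by
      intro p
      simp only [Set.indicator_apply, Set.mem_preimage, Pi.one_apply]
      rw [Finset.sum_boole, Set.ncard_eq_toFinset_card']
      simp
    simp only [h₁]
    rw [lintegral_finsetSum _ fun σ _ =>
      measurable_one.indicator ((hpres σ).measurable hBm)]
    have h₂ : ∀ σ : Fin N → Bool, ∫⁻ p, ((fun (p : Fin N × Bool → Ξ) j => p (e σ j)) ⁻¹' B).indicator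
        (1 : (Fin N × Bool → Ξ) → ENNReal) p ∂ν = ν B := by
      intro σ
      rw [lintegral_indicator_one ((hpres σ).measurable hBm),
        (hpres σ).measure_preimage hBm.nullMeasurableSet]
    simp [h₂]
  have hle : (2 : ENNReal) ^ N * (ν B * 2 ^ k) ≤ 2 ^ N * G := by
    rw [← mul_assoc, havg, ← lintegral_mul_const' _ _ (by simp)]
    calc _ ≤ ∫⁻ _, (2 ^ N * G : ENNReal) ∂ν := by
          refine lintegral_mono fun p => ?_
          rw [mul_comm ((2 : ENNReal) ^ N)]
          have := (Nat.cast_le (α := ENNReal)).2 (hcount p)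
          push_cast at this
          exact this
      _ = _ := by simp
  exact (ENNReal.mul_le_mul_iff_right (by simp) (by simp)).1 hle

/-- The ε-net bound for a countable family of sets with at most `G` traces on double samples:
a set of measure more than `ε` that `N` sample points miss is hit at least `ε N / 2` times by `N`
further points with probability at least one half. -/
theorem measure_exists_missed_mul_le {Ξ ι : Type*} [MeasurableSpace Ξ] [Countable ι]
    (μ : Measure Ξ) [IsProbabilityMeasure μ] {V : ι → Set Ξ} (hV : ∀ i, MeasurableSet (V i))
    {N G : ℕ} {ε : ℝ} (hN : 12 ≤ ε * N)
    (hG : ∀ p : Fin N × Bool → Ξ, (Set.range fun i => {j | p j ∈ V i}).ncard ≤ G) :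
    (Measure.pi fun _ : Fin N => μ) {s | ∃ i, ε < μ.real (V i) ∧ ∀ j, s j ∉ V i}
      * 2 ^ ⌈ε * N / 2⌉₊ ≤ 2 * G := by
  set k := ⌈ε * N / 2⌉₊ with hk
  obtain ⟨hBm, hB⟩ := measure_exists_missed_hit_mul_le μ hV k hG
  set B := {p : Fin N × Bool → Ξ |
    ∃ i, (∀ j, p (j, false) ∉ V i) ∧ k ≤ {j | p (j, true) ∈ V i}.ncard} with hB_def
  set ν := Measure.pi fun _ : Fin N => μ
  have hmerge := measurePreserving_double μ N
  rw [← hmerge.measure_preimage hBm.nullMeasurableSet,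
    Measure.prod_apply (hmerge.measurable hBm)] at hB
  have hhalf : {s : Fin N → Ξ | ∃ i, ε < μ.real (V i) ∧ ∀ j, s j ∉ V i} ⊆ {s | 2⁻¹ ≤
      ν (Prod.mk s ⁻¹' ((fun (s : (Fin N → Ξ) × (Fin N → Ξ)) (j : Fin N × Bool) =>
        cond j.2 (s.2 j.1) (s.1 j.1)) ⁻¹' B))} := by
    rintro s ⟨i, hi, hs⟩
    have h₁ := pi_count_lt_le_half μ (hV i) hi hN
    set C : Set (Fin N → Ξ) := {s | ({j | s j ∈ V i}.ncard : ℝ) < ε * N / 2} with hC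
    have h₂ : ν C ≤ 2⁻¹ := by
      have h := (ENNReal.le_ofReal_iff_toReal_le (measure_ne_top ν C) (by norm_num)).2 h₁
      refine h.trans (le_of_eq ?_)
      rw [one_div, ENNReal.ofReal_inv_of_pos two_pos, ENNReal.ofReal_ofNat]
    have h₃ : (1 : ENNReal) ≤ ν C + ν Cᶜ := by
      rw [← measure_univ (μ := ν), ← Set.union_compl_self C]
      exact measure_union_le _ _
    have h₄ : 2⁻¹ ≤ ν Cᶜ := by
      rw [← ENNReal.inv_two_add_inv_two] at h₃
      by_contra! h
      exact absurd h₃ (not_le.2 (ENNReal.add_lt_add_of_le_of_lt (by simp) h₂ h))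
    refine h₄.trans (measure_mono fun s' hs' => ⟨i, fun j => hs j, ?_⟩)
    rw [hk, Nat.ceil_le]
    exact not_lt.1 hs'
  have hmarkov := (mul_le_mul_right (measure_mono (μ := ν) hhalf) 2⁻¹).trans
    (mul_meas_ge_le_lintegral (measurable_measure_prodMk_left (hmerge.measurable hBm)) 2⁻¹)
  calc _ = 2 * (2⁻¹ * ν {s | ∃ i, ε < μ.real (V i) ∧ ∀ j, s j ∉ V i} * 2 ^ k) := by
        rw [← mul_assoc, ← mul_assoc, ENNReal.mul_inv_cancel (by simp) (by simp), one_mul]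
    _ ≤ 2 * G := by
        refine mul_le_mul_right ((mul_le_mul_left ?_ _).trans hB) _
        exact hmarkov

/-- The ε-net bound for random affine inequalities `A ξ z ≤ b ξ`. A violation of probability more
than `ε` at `z` persists, with a margin, at a nearby point of a countable dense set; this
reduces the claim to countable families. -/
theorem measure_exists_affine_missed_mul_le {Ξ E : Type*} [MeasurableSpace Ξ]
    [NormedAddCommGroup E] [NormedSpace ℝ E] [FiniteDimensional ℝ E]
    (μ : Measure Ξ) [IsProbabilityMeasure μ] (A : Ξ → E →ₗ[ℝ] ℝ) (b : Ξ → ℝ)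
    (hA : ∀ z, Measurable fun ξ => A ξ z) (hb : Measurable b)
    {N : ℕ} {ε : ℝ} (hε : 0 ≤ ε) (hN : 12 ≤ ε * N) :
    (Measure.pi fun _ : Fin N => μ)
      {s | ∃ z, ε < μ.real {ξ | b ξ < A ξ z} ∧ ∀ j, A (s j) z ≤ b (s j)} * 2 ^ ⌈ε * N / 2⌉₊
      ≤ 2 * (∑ k ∈ Finset.Iic (Module.finrank ℝ E), (2 * N).choose k : ℕ) := by
  -- a separability instance is needed for `denseSeq`
  have : ProperSpace E := FiniteDimensional.proper ℝ E
  set ν := Measure.pi fun _ : Fin N => μ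
  set u := TopologicalSpace.denseSeq E
  set r : ℕ → ℝ := fun a => 1 / ((a : ℝ) + 1) with hr
  have hr₀ : ∀ a, 0 < r a := fun a => Nat.one_div_pos_of_nat
  have hanti : Antitone r := fun a a' h => Nat.one_div_le_one_div h
  -- the violation at `z` extends with margin `r a` to the ball of radius `r a`
  set W : ℕ → E → Set Ξ := fun a z => {ξ | ∀ i, dist (u i) z < r a → b ξ + r a < A ξ (u i)} with hW
  have hWmono : ∀ z, Monotone fun a => W a z := by
    intro z a a' h ξ hξ i hi
    exact (add_le_add_right (hanti h) _).trans_lt (hξ i (hi.trans_le (hanti h)))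
  set F : ℕ → Set (Fin N → Ξ) := fun a =>
    {s | ∃ z, ε < μ.real (W a z) ∧ ∀ j, A (s j) z ≤ b (s j)} with hF
  have hFmono : Monotone F := by
    rintro a a' h s ⟨z, hz, hs⟩
    exact ⟨z, hz.trans_le (measureReal_mono (hWmono z h)), hs⟩
  have hcont : ∀ ξ, Continuous (A ξ) := fun ξ => (A ξ).continuous_of_finiteDimensional
  have hsub : {s : Fin N → Ξ | ∃ z, ε < μ.real {ξ | b ξ < A ξ z} ∧ ∀ j, A (s j) z ≤ b (s j)}
      ⊆ ⋃ a, F a := by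
    rintro s ⟨z, hz, hs⟩
    have hcover : {ξ | b ξ < A ξ z} ⊆ ⋃ a, W a z := by
      intro ξ hξ
      obtain ⟨c, hc₁, hc₂⟩ := exists_between (show b ξ < A ξ z from hξ)
      obtain ⟨ρ, hρ, hball⟩ := Metric.eventually_nhds_iff.1
        ((hcont ξ).continuousAt.eventually_const_lt hc₂)
      obtain ⟨a, ha⟩ := exists_nat_one_div_lt (lt_min hρ (sub_pos.2 hc₁))
      refine Set.mem_iUnion.2 ⟨a, fun i hi => ?_⟩
      have h₁ : r a < ρ := ha.trans_le (min_le_left _ _)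
      have h₂ : r a < c - b ξ := ha.trans_le (min_le_right _ _)
      linarith [hball (hi.trans h₁)]
    have hlt : ENNReal.ofReal ε < ⨆ a, μ (W a z) := by
      rw [← (hWmono z).measure_iUnion]
      exact ((ENNReal.ofReal_lt_iff_lt_toReal hε (measure_ne_top _ _)).2 hz).trans_le
        (measure_mono hcover)
    obtain ⟨a, ha⟩ := lt_iSup_iff.1 hlt
    exact Set.mem_iUnion.2
      ⟨a, z, (ENNReal.ofReal_lt_iff_lt_toReal hε (measure_ne_top _ _)).1 ha, hs⟩
  have hbound : ∀ a, ν (F a) * 2 ^ ⌈ε * N / 2⌉₊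
      ≤ 2 * (∑ k ∈ Finset.Iic (Module.finrank ℝ E), (2 * N).choose k : ℕ) := by
    intro a
    set V : ℕ → Set Ξ := fun i => {ξ | b ξ + r a < A ξ (u i)} with hV
    refine le_trans (mul_le_mul_left (measure_mono ?_) _)
      (measure_exists_missed_mul_le μ (V := V)
        (fun i => measurableSet_lt (hb.add_const _) (hA _)) hN fun p => ?_)
    · rintro s ⟨z, hz, hs⟩
      have hnear : ∀ᶠ z' in nhds z, dist z' z < r a ∧ ∀ j, A (s j) z' < b (s j) + r a := by
        refine Filter.Eventually.and (Metric.ball_mem_nhds z (hr₀ a)) (Filter.eventually_all.2 fun j => ?_)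
        exact (hcont (s j)).continuousAt.eventually_lt_const
          ((hs j).trans_lt (lt_add_of_pos_right _ (hr₀ a)))
      obtain ⟨_, ⟨i, rfl⟩, h₁, h₂⟩ :=
        (TopologicalSpace.denseRange_denseSeq E).inter_nhds_nonempty hnear
      exact ⟨i, hz.trans_le (measureReal_mono fun ξ hξ => hξ i h₁), fun j => (h₂ j).not_gt⟩
    · have h := ncard_range_trace_le (fun j => A (p j)) fun j => b (p j) + r a
      rw [Fintype.card_prod, Fintype.card_fin, Fintype.card_bool, mul_comm] at h
      refine (Set.ncard_le_ncard ?_ (Set.toFinite _)).trans h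
      rintro _ ⟨i, rfl⟩
      exact ⟨u i, rfl⟩
  refine (mul_le_mul_left ((measure_mono hsub).trans_eq hFmono.measure_iUnion) _).trans ?_
  rw [ENNReal.iSup_mul]
  exact iSup_le hbound

/-! ### The sample bound -/

/-- The two lower bounds on `ε N` that the ε-net theorem needs. -/
theorem mul_bounds_of_Ntilde_le {d N : ℕ} {ε δ : ℝ} (hε : ε ∈ Set.Ioo (0 : ℝ) 0.14)
    (hδ : δ ∈ Set.Ioo (0 : ℝ) 1) (hN : Ntilde d ε δ ≤ N) :
    4.1 * (Real.log (21.64 / δ) + 4.39 * d * Real.log (8 * Real.exp 1 / ε)) ≤ ε * N ∧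
      12 ≤ ε * N := by
  obtain ⟨hε₀, hε₁⟩ := hε
  obtain ⟨hδ₀, hδ₁⟩ := hδ
  have he : (2.7 : ℝ) < Real.exp 1 := by linarith [Real.exp_one_gt_d9]
  have hlog : 0 ≤ Real.log (8 * Real.exp 1 / ε) := by
    refine Real.log_nonneg ?_
    rw [le_div_iff₀ hε₀]
    linarith
  have hlogb : Real.log (8 * Real.exp 1 / ε) ≤ Real.logb 2 (8 * Real.exp 1 / ε) := by
    rw [Real.logb, le_div_iff₀ (Real.log_pos one_lt_two)]
    exact mul_le_of_le_one_right hlog (by linarith [Real.log_two_lt_d9])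
  have h₁ : 4.1 * (Real.log (21.64 / δ) + 4.39 * d * Real.log (8 * Real.exp 1 / ε)) ≤ ε * N := by
    calc _ ≤ 4.1 * (Real.log (21.64 / δ) + 4.39 * d * Real.logb 2 (8 * Real.exp 1 / ε)) := by
          gcongr
      _ = ε * Ntilde d ε δ := by
          rw [Ntilde]
          field_simp
      _ ≤ ε * N := by gcongr
  refine ⟨h₁, ?_⟩
  -- `exp 3 < 21.64`
  have h₂ : 3 ≤ Real.log (21.64 / δ) := by
    rw [Real.le_log_iff_exp_le (by positivity), le_div_iff₀ hδ₀]
    have h₃ : Real.exp 3 ≤ 21.64 := by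
      have : Real.exp 3 = Real.exp 1 ^ 3 := by rw [← Real.exp_nat_mul]; norm_num
      rw [this]
      calc Real.exp 1 ^ 3 ≤ 2.72 ^ 3 := by
            gcongr
            linarith [Real.exp_one_lt_d9]
        _ ≤ 21.64 := by norm_num
    nlinarith [Real.exp_pos 3]
  have h₄ : 0 ≤ 4.39 * d * Real.log (8 * Real.exp 1 / ε) := by positivity
  linarith

theorem pos_of_Ntilde_le {d N : ℕ} {ε δ : ℝ} (hε : ε ∈ Set.Ioo (0 : ℝ) 0.14)
    (hδ : δ ∈ Set.Ioo (0 : ℝ) 1) (hN : Ntilde d ε δ ≤ N) : 0 < N := by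
  rcases N.eq_zero_or_pos with rfl | h
  · have := (mul_bounds_of_Ntilde_le hε hδ hN).2
    norm_num at this
  · exact h

/-- The sample bound suffices for the ε-net bound. The Sauer–Shelah sum is estimated with the
parameter `t = ε / 20`, at the price `exp (ε N / 10)`, and `log 2 / 2 - 1 / 10 > 1 / 4.1`. -/
theorem two_mul_sum_choose_le {d N : ℕ} {ε δ : ℝ} (hε : ε ∈ Set.Ioo (0 : ℝ) 0.14)
    (hδ : δ ∈ Set.Ioo (0 : ℝ) 1) (hN : Ntilde d ε δ ≤ N) :
    2 * (∑ k ∈ Finset.Iic d, ((2 * N).choose k : ℝ)) ≤ δ * 2 ^ ⌈ε * N / 2⌉₊ := by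
  obtain ⟨h₁, h₁₂⟩ := mul_bounds_of_Ntilde_le hε hδ hN
  obtain ⟨hε₀, hε₁⟩ := hε
  obtain ⟨hδ₀, hδ₁⟩ := hδ
  have he : (2.7 : ℝ) < Real.exp 1 := by linarith [Real.exp_one_gt_d9]
  have hsum := sum_choose_mul_pow_le (2 * N) d (t := ε / 20) (by positivity) (by linarith)
  have hlog20 : Real.log (20 / ε) ≤ Real.log (8 * Real.exp 1 / ε) := by
    refine Real.log_le_log (by positivity) ?_
    gcongr
    linarith
  have hlog20' : 0 ≤ Real.log (20 / ε) := by
    refine Real.log_nonneg ?_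
    rw [le_div_iff₀ hε₀]
    linarith
  have hpow : (ε / 20) ^ d = Real.exp (-(d * Real.log (20 / ε))) := by
    rw [Real.exp_neg, Real.exp_nat_mul, Real.exp_log (by positivity), ← inv_pow, inv_div]
  have htwo : Real.exp (Real.log 2 * (ε * N / 2)) ≤ 2 ^ ⌈ε * N / 2⌉₊ := by
    rw [← Real.exp_log (x := 2 ^ _) (by positivity), Real.log_pow, Real.exp_le_exp, mul_comm]
    have := Real.log_pos one_lt_two
    gcongr
    exact Nat.le_ceil _
  have hδlog : Real.log (2 / δ) ≤ Real.log (21.64 / δ) := by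
    refine Real.log_le_log (by positivity) ?_
    gcongr
    norm_num
  have hδlog' : 0 ≤ Real.log (2 / δ) := by
    refine Real.log_nonneg ?_
    rw [le_div_iff₀ hδ₀]
    linarith
  have hkey : Real.log (2 / δ) + ε * N / 10 + d * Real.log (20 / ε)
      ≤ Real.log 2 * (ε * N / 2) := by
    have hlog2 : 0.6931 < Real.log 2 := by linarith [Real.log_two_gt_d9]
    have hd : (d : ℝ) * Real.log (20 / ε) ≤ d * Real.log (8 * Real.exp 1 / ε) := by gcongr
    have hd' : 0 ≤ (d : ℝ) * Real.log (20 / ε) := by positivity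
    nlinarith
  have hS : ∑ k ∈ Finset.Iic d, ((2 * N).choose k : ℝ)
      ≤ Real.exp (ε * N / 10 + d * Real.log (20 / ε)) := by
    rw [hpow, Real.exp_neg, ← div_eq_mul_inv, div_le_iff₀ (Real.exp_pos _), ← Real.exp_add] at hsum
    refine hsum.trans (le_of_eq ?_)
    push_cast
    ring_nf
  have h2δ : Real.exp (Real.log (2 / δ)) = 2 / δ := Real.exp_log (by positivity)
  have hfin : 2 / δ * ∑ k ∈ Finset.Iic d, ((2 * N).choose k : ℝ) ≤ 2 ^ ⌈ε * N / 2⌉₊ := by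
    refine le_trans ?_ htwo
    calc _ ≤ 2 / δ * Real.exp (ε * N / 10 + d * Real.log (20 / ε)) := by gcongr
      _ = Real.exp (Real.log (2 / δ) + ε * N / 10 + d * Real.log (20 / ε)) := by
          rw [← h2δ, ← Real.exp_add, h2δ, add_assoc]
      _ ≤ _ := Real.exp_le_exp.2 hkey
  calc _ = δ * (2 / δ * ∑ k ∈ Finset.Iic d, ((2 * N).choose k : ℝ)) := by field_simp
    _ ≤ _ := by gcongr

/-- With the prescribed number of samples, the event that some `z` satisfies all sampled
inequalities but violates the random inequality with probability more than `ε` has outer measure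
at most `δ`. -/
theorem measure_exists_affine_missed_le {Ξ E : Type*} [MeasurableSpace Ξ]
    [NormedAddCommGroup E] [NormedSpace ℝ E] [FiniteDimensional ℝ E]
    (μ : Measure Ξ) [IsProbabilityMeasure μ] (A : Ξ → E →ₗ[ℝ] ℝ) (b : Ξ → ℝ)
    (hA : ∀ z, Measurable fun ξ => A ξ z) (hb : Measurable b) {N : ℕ} {ε δ : ℝ}
    (hε : ε ∈ Set.Ioo (0 : ℝ) 0.14) (hδ : δ ∈ Set.Ioo (0 : ℝ) 1)
    (hN : Ntilde (Module.finrank ℝ E) ε δ ≤ N) :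
    (Measure.pi fun _ : Fin N => μ)
      {s | ∃ z, ε < μ.real {ξ | b ξ < A ξ z} ∧ ∀ j, A (s j) z ≤ b (s j)} ≤ ENNReal.ofReal δ := by
  have h₁ := measure_exists_affine_missed_mul_le μ A b hA hb hε.1.le
    (mul_bounds_of_Ntilde_le hε hδ hN).2
  have h₂ := ENNReal.ofReal_le_ofReal (two_mul_sum_choose_le hε hδ hN)
  rw [ENNReal.ofReal_mul hδ.1.le, ENNReal.ofReal_pow two_pos.le, ENNReal.ofReal_ofNat,
    ENNReal.ofReal_mul two_pos.le, ENNReal.ofReal_ofNat, ← Nat.cast_sum,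
    ENNReal.ofReal_natCast] at h₂
  exact (ENNReal.mul_le_mul_iff_left (by simp) (by simp)).1 (h₁.trans h₂)

/-! ### Inner probability and the laws of the scheme -/

variable {n m mw nq px pu pT T : ℕ}

theorem probGE_of_measure_compl_le {Ω : Type*} [MeasurableSpace Ω] {P : Measure Ω}
    [IsProbabilityMeasure P] {E : Set Ω} {p : ℝ} (hp : 0 ≤ p)
    (h : P Eᶜ ≤ ENNReal.ofReal p) : ProbGE P E (1 - p) := by
  refine ⟨(toMeasurable P Eᶜ)ᶜ, (measurableSet_toMeasurable _ _).compl, ?_, ?_⟩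
  · rw [Set.compl_subset_comm]
    exact subset_toMeasurable _ _
  · rw [prob_compl_eq_one_sub (measurableSet_toMeasurable _ _), measure_toMeasurable,
      ENNReal.ofReal_sub _ hp, ENNReal.ofReal_one]
    exact tsub_le_tsub_left h _

theorem probGE_of_ae {Ω : Type*} [MeasurableSpace Ω] {P : Measure Ω}
    [IsProbabilityMeasure P] {E : Set Ω} {p : ℝ} (hp : 0 ≤ p) (h : ∀ᵐ ω ∂P, ω ∈ E) :
    ProbGE P E (1 - p) :=
  probGE_of_measure_compl_le hp ((mem_ae_iff.1 h).trans_le zero_le)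

instance (S : Plant n m mw nq) : IsProbabilityMeasure (S.horizonLaw T) :=
  inferInstanceAs (IsProbabilityMeasure (Measure.pi fun _ => S.law))

instance (S : Plant n m mw nq) (c : Counts T) : IsProbabilityMeasure (sampleLaw S c) :=
  inferInstanceAs (IsProbabilityMeasure (Measure.pi fun _ => S.horizonLaw T))

instance (S : Plant n m mw nq) : IsProbabilityMeasure S.onlineLaw :=
  inferInstanceAs (IsProbabilityMeasure (Measure.infinitePi fun _ => S.law))

theorem Plant.Standing.ae_admissible {S : Plant n m mw nq} (hS : S.Standing) :
    ∀ᵐ d ∂S.onlineLaw, S.Admissible d := by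
  refine ae_all_iff.2 fun k => ?_
  exact (measurePreserving_eval_infinitePi (fun _ : ℕ => S.law) k).quasiMeasurePreserving.ae
    hS.ae_mem

/-! ### Predictions as affine functions of the state and the corrections -/

/-- The linear part of `predState`: the predicted state with the additive disturbances removed. -/
def predLinear (S : Plant n m mw nq) (D : Design n m px pu pT) (ξ : Fin T → Noise nq mw) :
    ℕ → (Vec n × (Fin T → Vec m)) →ₗ[ℝ] Vec n
  | 0 => LinearMap.fst ℝ _ _
  | l + 1 =>
    if h : l < T then
      (S.A (ξ ⟨l, h⟩).1).mulVecLin ∘ₗ predLinear S D ξ l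
        + (S.B (ξ ⟨l, h⟩).1).mulVecLin ∘ₗ (D.K.mulVecLin ∘ₗ predLinear S D ξ l
          + LinearMap.proj ⟨l, h⟩ ∘ₗ LinearMap.snd ℝ _ _)
    else predLinear S D ξ l

theorem predState_eq_add (S : Plant n m mw nq) (D : Design n m px pu pT)
    (ξ : Fin T → Noise nq mw) (x : Vec n) (v : Fin T → Vec m) (l : ℕ) :
    predState S D x v ξ l = predLinear S D ξ l (x, v) + predState S D 0 0 ξ l := by
  induction l with
  | zero => simp [predState, predLinear]
  | succ l ih =>
    rw [predState, predState, predLinear]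
    split_ifs with h
    · rw [ih]
      simp only [Plant.step, Matrix.mulVec_add, LinearMap.add_apply, LinearMap.comp_apply,
        Matrix.mulVecLin_apply, LinearMap.proj_apply, LinearMap.snd_apply, Pi.zero_apply,
        Matrix.mulVec_zero]
      abel
    · exact ih

/-- Only the corrections before step `l` act on the state predicted at step `l`. -/
theorem predState_congr (S : Plant n m mw nq) (D : Design n m px pu pT)
    (ξ : Fin T → Noise nq mw) (x : Vec n) {v v' : Fin T → Vec m} {l : ℕ}
    (h : ∀ j : Fin T, (j : ℕ) < l → v j = v' j) :
    predState S D x v ξ l = predState S D x v' ξ l := by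
  induction l with
  | zero => rfl
  | succ l ih =>
    rw [predState, predState]
    have := ih fun j hj => h j (hj.trans l.lt_succ_self)
    split_ifs with hl
    · rw [this, h ⟨l, hl⟩ l.lt_succ_self]
    · exact this

theorem measurable_mulVec {Ω : Type*} [MeasurableSpace Ω] {a b : ℕ}
    {M : Ω → Matrix (Fin a) (Fin b) ℝ} {y : Ω → Vec b}
    (hM : ∀ i j, Measurable fun ω => M ω i j) (hy : Measurable y) :
    Measurable fun ω => M ω *ᵥ y ω := by
  refine measurable_pi_lambda _ fun i => ?_
  simp only [Matrix.mulVec, dotProduct]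
  exact Finset.measurable_sum _ fun j _ => (hM i j).mul (measurable_pi_iff.1 hy j)

theorem Plant.Standing.measurable_predState {S : Plant n m mw nq} (hS : S.Standing)
    (D : Design n m px pu pT) (x : Vec n) (v : Fin T → Vec m) (l : ℕ) :
    Measurable fun ξ : Fin T → Noise nq mw => predState S D x v ξ l := by
  induction l with
  | zero => exact measurable_const
  | succ l ih =>
    simp only [predState]
    split_ifs with h
    · have hq : Measurable fun ξ : Fin T → Noise nq mw => (ξ ⟨l, h⟩).1 := by fun_prop
      have hw : Measurable fun ξ : Fin T → Noise nq mw => (ξ ⟨l, h⟩).2 := by fun_prop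
      have hKx := measurable_mulVec (M := fun _ => D.K) (fun _ _ => measurable_const) ih
      have h₁ := measurable_mulVec (fun i j => (hS.measurable_A i j).comp hq) ih
      have h₂ := measurable_mulVec (fun i j => (hS.measurable_B i j).comp hq)
        (hKx.add_const (v ⟨l, h⟩))
      have h₃ := measurable_mulVec (fun i j => (hS.measurable_Bw i j).comp hq) hw
      exact (h₁.add h₂).add h₃
    · exact ih

/-- Extension of the first `l` corrections by zero to the whole horizon, as a linear map. -/
def extendCorrections (m : ℕ) {T : ℕ} (l : Fin T) : (Fin l → Vec m) →ₗ[ℝ] (Fin T → Vec m) where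
  toFun w j := if h : j < l then w ⟨j, h⟩ else 0
  map_add' w w' := by
    ext j i
    by_cases h : j < l <;> simp [h]
  map_smul' a w := by
    ext j i
    by_cases h : j < l <;> simp [h]

/-- A state constraint at step `l` is a random affine inequality in the `n + l * m` unknowns
`x, v₀, …, v_{l-1}`: with confidence `1 - δ`, whatever satisfies it on all its samples satisfies it
with probability at least `1 - ε`. -/
theorem probGE_sampleLaw_forall_predState {S : Plant n m mw nq} (hS : S.Standing)
    (D : Design n m px pu pT) (c : Counts T) (α : Fin px) (l : Fin T) {ε δ : ℝ}
    (hε : ε ∈ Set.Ioo (0 : ℝ) 0.14) (hδ : δ ∈ Set.Ioo (0 : ℝ) 1)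
    (hN : Ntilde (n + l * m) ε δ ≤ c.Nx l) :
    ProbGE (sampleLaw S c)
      {s | ∀ z ∈ sampledSet S D s,
        ProbGE (S.horizonLaw T) {ξ | (D.Hx *ᵥ predState S D z.1 z.2 ξ l) α ≤ D.hx α} (1 - ε)}
      (1 - δ) := by
  set row : Vec n →ₗ[ℝ] ℝ := LinearMap.proj α ∘ₗ D.Hx.mulVecLin
  set A : (Fin T → Noise nq mw) → (Vec n × (Fin l → Vec m)) →ₗ[ℝ] ℝ := fun ξ =>
    row ∘ₗ predLinear S D ξ l ∘ₗ LinearMap.prodMap LinearMap.id (extendCorrections m l) with hA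
  set b : (Fin T → Noise nq mw) → ℝ := fun ξ =>
    D.hx α - (D.Hx *ᵥ predState S D 0 0 ξ l) α with hb
  have hpred : ∀ ξ y, A ξ y - b ξ
      = (D.Hx *ᵥ predState S D y.1 (extendCorrections m l y.2) ξ l) α - D.hx α := by
    intro ξ y
    rw [predState_eq_add, Matrix.mulVec_add, Pi.add_apply]
    simp only [hA, hb, row, LinearMap.comp_apply, LinearMap.prodMap_apply, LinearMap.id_apply,
      LinearMap.proj_apply, Matrix.mulVecLin_apply]
    ring
  have hmeas : ∀ x v, Measurable fun ξ : Fin T → Noise nq mw =>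
      (D.Hx *ᵥ predState S D x v ξ l) α := fun x v =>
    (measurable_pi_apply α).comp
      (measurable_mulVec (M := fun _ => D.Hx) (fun _ _ => measurable_const)
        (hS.measurable_predState D x v l))
  have hbm : Measurable b := measurable_const.sub (hmeas 0 0)
  have hAm : ∀ y, Measurable fun ξ => A ξ y := by
    intro y
    have : (fun ξ => A ξ y) = fun ξ =>
        (D.Hx *ᵥ predState S D y.1 (extendCorrections m l y.2) ξ l) α - D.hx α + b ξ := by
      funext ξ
      rw [← hpred, sub_add_cancel]
    rw [this]
    exact ((hmeas _ _).sub_const _).add hbm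
  have hdim : Module.finrank ℝ (Vec n × (Fin l → Vec m)) = n + l * m := by
    simp [Module.finrank_prod, Module.finrank_pi_fintype]
  have hbad := measure_exists_affine_missed_le (S.horizonLaw T) A b hAm hbm hε hδ
    (hdim.symm ▸ hN)
  have hpres := measurePreserving_comp_pi (S.horizonLaw T)
    (f := fun i : Fin (c.Nx l) => (Sum.inl ⟨l, i⟩ : c.Idx))
    (fun i i' h => by simpa using h)
  refine probGE_of_measure_compl_le hδ.1.le (le_trans ?_ hbad)
  refine le_trans (measure_mono ?_) (hpres.measure_preimage_le _)
  intro s hs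
  simp only [Set.mem_compl_iff, Set.mem_ofPred_eq, not_forall] at hs
  obtain ⟨z, hz, hnot⟩ := hs
  set y : Vec n × (Fin l → Vec m) := (z.1, fun j => z.2 ⟨j, j.2.trans l.2⟩) with hy
  have hpz : ∀ ξ, A ξ y - b ξ = (D.Hx *ᵥ predState S D z.1 z.2 ξ l) α - D.hx α := by
    intro ξ
    rw [hpred, predState_congr S D ξ z.1 (v' := z.2)]
    intro j hj
    have hjl : j < l := hj
    simp [extendCorrections, hy, hjl]
  refine ⟨y, ?_, fun j => ?_⟩
  · by_contra! hle
    refine hnot (probGE_of_measure_compl_le hε.1.le ?_)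
    refine le_trans (measure_mono fun ξ hξ => ?_)
      ((ENNReal.le_ofReal_iff_toReal_le (measure_ne_top _ _) hε.1.le).2 hle)
    have h₁ := hpz ξ
    have h₂ : D.hx α < (D.Hx *ᵥ predState S D z.1 z.2 ξ l) α := not_le.1 hξ
    change b ξ < A ξ y
    linarith
  · have h₁ := hpz (s (Sum.inl ⟨l, j⟩))
    have h₂ := hz.1 l j α
    linarith

/-! ### The closed loop -/

section ClosedLoop

variable [NeZero T] {S : Plant n m mw nq} {D : Design n m px pu pT} {c : Counts T}
  {s : Samples nq mw c} {κ : Vec n → Fin T → Vec m}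

/-- Recursive feasibility: the online program is feasible on the maximal invariant set. -/
theorem IsLaw.mem_feasible (hκ : IsLaw S D s κ) {x : Vec n} (hx : x ∈ maxRCI S D s) :
    κ x ∈ feasible S D s x := by
  obtain ⟨_, ⟨v, rfl, hv⟩, hstep⟩ := (isGreatest_maxRCI S D s).1 x hx
  exact (hκ x ⟨v, hv, hstep⟩).1

theorem IsLaw.step_mem_maxRCI (hκ : IsLaw S D s κ) {x : Vec n} (hx : x ∈ maxRCI S D s)
    {e : Noise nq mw} (he : e.1 ∈ S.QSet ∧ e.2 ∈ S.WSet) :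
    S.step x (appliedInput D κ x) e ∈ maxRCI S D s :=
  (hκ.mem_feasible hx).2 e.1 he.1 e.2 he.2

theorem IsLaw.closedLoop_mem_maxRCI (hκ : IsLaw S D s κ) {x₀ : Vec n}
    (hx₀ : x₀ ∈ maxRCI S D s) {d : ℕ → Noise nq mw} (hd : S.Admissible d) (k : ℕ) :
    closedLoop S D κ x₀ d k ∈ maxRCI S D s := by
  induction k with
  | zero => exact hx₀
  | succ k ih => exact hκ.step_mem_maxRCI ih (hd k)

/-- The state constraint at step `0` involves no disturbance, so a single sample enforces it on the
whole maximal invariant set. -/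
theorem mulVec_le_of_mem_maxRCI (h0 : 0 < c.Nx 0) {x : Vec n} (hx : x ∈ maxRCI S D s) :
    D.Hx *ᵥ x ≤ D.hx := by
  obtain ⟨_, ⟨v, -, hv⟩, -⟩ := (isGreatest_maxRCI S D s).1 x hx
  simpa [predState] using hv.1 0 ⟨0, h0⟩

/-- The input applied at step `0` does not depend on the predicted disturbances either. -/
theorem IsLaw.appliedInput_le (hκ : IsLaw S D s κ) (h0 : 0 < c.Nu 0) {x : Vec n}
    (hx : x ∈ maxRCI S D s) : D.Hu *ᵥ appliedInput D κ x ≤ D.hu := by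
  simpa [predInput, predState, appliedInput] using (hκ.mem_feasible hx).1.2.1 0 ⟨0, h0⟩

end ClosedLoop

end OSSMPC

theorem proposition2 {n m mw nq px pu pT T : ℕ} [NeZero T]
    (S : OSSMPC.Plant n m mw nq) (hS : S.Standing) (D : OSSMPC.Design n m px pu pT)
    (c : OSSMPC.Counts T)
    (εx : Fin px → ℝ) (εu : Fin pu → ℝ) (εT : Fin pT → ℝ) (δ : ℝ)
    (hεx : ∀ α, εx α ∈ Set.Ioo (0 : ℝ) 0.14) (hεu : ∀ β, εu β ∈ Set.Ioo (0 : ℝ) 0.14)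
    (hεT : ∀ γ, εT γ ∈ Set.Ioo (0 : ℝ) 0.14) (hδ : δ ∈ Set.Ioo (0 : ℝ) 1)
    (hNx : ∀ (l : Fin T) (α : Fin px), OSSMPC.Ntilde (n + l * m) (εx α) δ ≤ (c.Nx l : ℝ))
    (hNu : ∀ (l : Fin T) (β : Fin pu), OSSMPC.Ntilde (n + l * m) (εu β) δ ≤ (c.Nu l : ℝ))
    (hNT : ∀ γ : Fin pT, OSSMPC.Ntilde (n + T * m) (εT γ) δ ≤ (c.NT : ℝ)) :
    -- hard input constraints: for every multisample and every admissible disturbance sequence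
    (∀ s : OSSMPC.Samples nq mw c, ∀ κ, OSSMPC.IsLaw S D s κ → ∀ x₀ ∈ OSSMPC.maxRCI S D s,
      ∀ d, S.Admissible d → ∀ k : ℕ,
        D.Hu *ᵥ OSSMPC.appliedInput D κ (OSSMPC.closedLoop S D κ x₀ d k) ≤ D.hu) ∧
    -- chance constraints on the closed-loop states, with confidence `1 - δ`: for the joint law of
    -- the disturbances, and conditionally on each reachable preceding state
    (∀ α : Fin px, OSSMPC.ProbGE (OSSMPC.sampleLaw S c)
      {s | ∀ κ, OSSMPC.IsLaw S D s κ → ∀ x₀ ∈ OSSMPC.maxRCI S D s,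
        (∀ k : ℕ, 1 ≤ k → OSSMPC.ProbGE S.onlineLaw
          {d | (D.Hx *ᵥ OSSMPC.closedLoop S D κ x₀ d k) α ≤ D.hx α} (1 - εx α)) ∧
        (∀ d, S.Admissible d → ∀ k : ℕ, OSSMPC.ProbGE S.law
          {e | (D.Hx *ᵥ S.step (OSSMPC.closedLoop S D κ x₀ d k)
              (OSSMPC.appliedInput D κ (OSSMPC.closedLoop S D κ x₀ d k)) e) α ≤ D.hx α}
          (1 - εx α))}
      (1 - δ)) ∧
    -- chance constraints on the states predicted along the closed loop, at each step `l` of the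
    -- horizon, conditionally on each reachable state, with confidence `1 - δ`
    (∀ (α : Fin px) (l : Fin T), OSSMPC.ProbGE (OSSMPC.sampleLaw S c)
      {s | ∀ κ, OSSMPC.IsLaw S D s κ → ∀ x₀ ∈ OSSMPC.maxRCI S D s,
        ∀ d, S.Admissible d → ∀ k : ℕ, OSSMPC.ProbGE (S.horizonLaw T)
          {ξ | (D.Hx *ᵥ OSSMPC.predState S D (OSSMPC.closedLoop S D κ x₀ d k)
              (κ (OSSMPC.closedLoop S D κ x₀ d k)) ξ l) α ≤ D.hx α}
          (1 - εx α)}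
      (1 - δ)) := by
  refine ⟨fun s κ hκ x₀ hx₀ d hd k β => ?_, fun α => ?_, fun α l => ?_⟩
  · exact hκ.appliedInput_le (OSSMPC.pos_of_Ntilde_le (hεu β) hδ (hNu 0 β))
      (hκ.closedLoop_mem_maxRCI hx₀ hd k) β
  -- the chance constraints on the closed loop hold for every multisample, almost surely
  · have h0 := OSSMPC.pos_of_Ntilde_le (hεx α) hδ (hNx 0 α)
    refine OSSMPC.probGE_of_ae hδ.1.le (ae_of_all _ fun s κ hκ x₀ hx₀ => ⟨fun k _ => ?_, ?_⟩)
    · refine OSSMPC.probGE_of_ae (hεx α).1.le ?_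
      filter_upwards [hS.ae_admissible] with d hd
      exact OSSMPC.mulVec_le_of_mem_maxRCI h0 (hκ.closedLoop_mem_maxRCI hx₀ hd k) α
    · intro d hd k
      refine OSSMPC.probGE_of_ae (hεx α).1.le ?_
      filter_upwards [hS.ae_mem] with e he
      exact OSSMPC.mulVec_le_of_mem_maxRCI h0
        (hκ.step_mem_maxRCI (hκ.closedLoop_mem_maxRCI hx₀ hd k) he) α
  · obtain ⟨F, hF, hsub, hP⟩ :=
      OSSMPC.probGE_sampleLaw_forall_predState hS D c α l (hεx α) hδ (hNx l α)
    refine ⟨F, hF, fun s hs κ hκ x₀ hx₀ d hd k => ?_, hP⟩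
    exact hsub hs (_, _) (hκ.mem_feasible (hκ.closedLoop_mem_maxRCI hx₀ hd k)).1
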